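/- Let $q>p>1$ be two relatively prime integers. For a nonnegative integer $n$, let $f_{p,q}(n)$ be the number of different expressions of $n$ as a sum of distinct terms taken from $\{p^{\alpha}q^{\beta}:\alpha,\beta\in\mathbb{Z}_{\ge 0}\}$ (the order of the terms being irrelevant). Then $$ \log f_{p,q}(n)\sim \frac{\log 2\,(\log n)^2}{2\log p\log q}\qquad\text{as } n\rightarrow\infty, $$ that is, the quotient of the two sides tends to $1$ as $n\to\infty$. -/

import Mathlib

/-- The set `{p ^ α * q ^ β : α, β ∈ ℕ}`. -/
def powerProducts (p q : ℕ) : Set ℕ :=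
  {m : ℕ | ∃ α β : ℕ, m = p ^ α * q ^ β}

/-- The expressions of `n` as a sum of distinct terms taken from `powerProducts p q`
(the order of the terms is irrelevant, so an expression is a finite set of terms). -/
def expressions (p q n : ℕ) : Set (Finset ℕ) :=
  {S : Finset ℕ | (∀ m ∈ S, m ∈ powerProducts p q) ∧ ∑ m ∈ S, m = n}

/-- There are only finitely many expressions, so that counting them by `Set.ncard` is meaningful. -/
theorem expressions_finite (p q n : ℕ) : (expressions p q n).Finite := by
  refine Set.Finite.subset (Finset.range (n + 1)).powerset.finite_toSet ?_
  rintro S ⟨-, hS⟩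
  simp only [Finset.coe_powerset, Set.mem_preimage, Set.mem_powerset_iff, Finset.coe_subset]
  intro m hm
  have h : m ≤ ∑ k ∈ S, k := Finset.single_le_sum (f := fun k => k) (fun _ _ => Nat.zero_le _) hm
  exact Finset.mem_range.2 (by omega)

/-- `numExpressions p q n`: the number of different expressions of `n` as a sum of distinct terms taken from
`{p ^ α * q ^ β : α, β ∈ ℕ}`. -/
noncomputable def numExpressions (p q n : ℕ) : ℕ := (expressions p q n).ncard

/-! An expression of n is a subset of the power products up to n. Taking logarithms, these are the
lattice points of a triangle of area (log n)² / (2 log p log q), which gives the upper bound.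

For the lower bound, a sparse part of the power products already suffices: by
`exists_complete_of_bounded_exponent`, all large integers are sums of distinct terms having one
exponent below some K. Any set of terms with both exponents at least K whose total leaves enough
room therefore extends to an expression of n. Using such terms up to about n / (log n)³ loses
nothing in the leading order.

Completeness: a strip of power products has sums with bounded gaps. A pigeonhole on two scaled
strips yields pairs of sums, built from arbitrarily large terms, with a fixed difference D; stacking
pairs gives long progressions of step D. Small sums cover all residues modulo D, and a rescaled
strip reaches every large n up to a bounded error, which the progression absorbs. -/

/-- The sums of finitely many distinct elements of `X`. -/
def distinctSums (X : Set ℕ) : Set ℕ := {n | ∃ A : Finset ℕ, ↑A ⊆ X ∧ ∑ m ∈ A, m = n}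

theorem zero_mem_distinctSums (X : Set ℕ) : 0 ∈ distinctSums X := ⟨∅, by simp⟩

theorem distinctSums_mono {X Y : Set ℕ} (h : X ⊆ Y) : distinctSums X ⊆ distinctSums Y := by
  rintro n ⟨A, hA, hs⟩
  exact ⟨A, hA.trans h, hs⟩

theorem add_mem_distinctSums {X Y : Set ℕ} (h : Disjoint X Y) {m n : ℕ}
    (hm : m ∈ distinctSums X) (hn : n ∈ distinctSums Y) : m + n ∈ distinctSums (X ∪ Y) := by
  obtain ⟨A, hA, rfl⟩ := hm
  obtain ⟨B, hB, rfl⟩ := hn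
  have hd : Disjoint A B := by
    rw [← Finset.disjoint_coe]
    exact h.mono hA hB
  refine ⟨A ∪ B, ?_, Finset.sum_union hd⟩
  rw [Finset.coe_union]
  exact Set.union_subset_union hA hB

theorem mul_mem_distinctSums {X : Set ℕ} {c n : ℕ} (hc : 0 < c) (hn : n ∈ distinctSums X) :
    c * n ∈ distinctSums ((c * ·) '' X) := by
  obtain ⟨A, hA, rfl⟩ := hn
  refine ⟨A.image (c * ·), ?_, ?_⟩
  · rw [Finset.coe_image]
    exact Set.image_mono hA
  · rw [Finset.sum_image, Finset.mul_sum]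
    intro x _ y _ hxy
    exact Nat.eq_of_mul_eq_mul_left hc hxy

/-- A sum of distinct elements of `X` only uses elements up to its own size. -/
theorem mem_distinctSums_of_le {X : Set ℕ} {n e : ℕ} (hn : n ∈ distinctSums X) (he : n ≤ e) :
    n ∈ distinctSums (X ∩ {t | t ≤ e}) := by
  obtain ⟨A, hA, rfl⟩ := hn
  refine ⟨A, fun t ht => ⟨hA ht, ?_⟩, rfl⟩
  exact (Finset.single_le_sum (f := fun k => k) (fun _ _ => Nat.zero_le _)
    (Finset.mem_coe.1 ht)).trans he

theorem pow_mul_pow_inj {p q : ℕ} (hp : 1 < p) (hq : 1 < q) (h : Nat.Coprime p q)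
    {a b c d : ℕ} (e : p ^ a * q ^ b = p ^ c * q ^ d) : a = c ∧ b = d := by
  have h1 : p ^ a ∣ p ^ c :=
    (Nat.Coprime.pow a d h).dvd_of_dvd_mul_right (e ▸ Dvd.intro _ rfl)
  have h2 : p ^ c ∣ p ^ a :=
    (Nat.Coprime.pow c b h).dvd_of_dvd_mul_right (e ▸ Dvd.intro _ rfl)
  have h3 : a = c := Nat.pow_right_injective hp (Nat.dvd_antisymm h1 h2)
  subst h3
  exact ⟨rfl, Nat.pow_right_injective hq (Nat.eq_of_mul_eq_mul_left (by positivity) e)⟩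

/-! ### Bounded gaps -/

/-- Greedy subtraction of elements of a finite set whose elements lie in `[m, M)`. -/
theorem exists_subset_sum_le {m M : ℕ} (L : Finset ℕ) (hL : ∀ t ∈ L, m ≤ t ∧ t < M) (n : ℕ) :
    ∃ A ⊆ L, ∑ t ∈ A, t ≤ n ∧ (n < ∑ t ∈ A, t + M ∨ L.card * m ≤ ∑ t ∈ A, t) := by
  induction L using Finset.induction_on with
  | empty => exact ⟨∅, by simp⟩
  | insert t L ht ih =>
    obtain ⟨A, hA, hle, hor⟩ := ih fun u hu => hL u (Finset.mem_insert_of_mem hu)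
    by_cases hlt : n < ∑ t ∈ A, t + M
    · exact ⟨A, hA.trans (Finset.subset_insert _ _), hle, Or.inl hlt⟩
    · have hcard := hor.resolve_left hlt
      have htm := hL t (Finset.mem_insert_self _ _)
      refine ⟨insert t A, Finset.insert_subset_insert _ hA, ?_, Or.inr ?_⟩
      · rw [Finset.sum_insert fun h => ht (hA h)]
        omega
      · rw [Finset.sum_insert fun h => ht (hA h), Finset.card_insert_of_notMem ht, add_mul]
        omega

theorem exists_gap_of_dense_levels {b i₀ : ℕ} (hb : 1 < b) {F : Set ℕ}
    (hF : ∀ i, i₀ ≤ i → ∃ L : Finset ℕ, ↑L ⊆ F ∧ L.card = b ^ 2 ∧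
      ∀ t ∈ L, b ^ i ≤ t ∧ t < b ^ (i + 1)) :
    ∃ G, 0 < G ∧ ∀ n, ∃ s ∈ distinctSums F, s ≤ n ∧ n < s + G := by
  have key : ∀ k n, n < b ^ (i₀ + 1 + k) →
      ∃ s ∈ distinctSums (F ∩ {t | t < b ^ (i₀ + k)}), s ≤ n ∧ n < s + b ^ (i₀ + 1) := by
    intro k
    induction k with
    | zero => exact fun n hn => ⟨0, zero_mem_distinctSums _, by simp, by simpa using hn⟩
    | succ k ih =>
      intro n hn
      obtain ⟨L, hLF, hcard, hL⟩ := hF (i₀ + k) (by omega)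
      obtain ⟨A, hA, hle, hor⟩ := exists_subset_sum_le L hL n
      -- The b² elements of the level sum to at least b ^ (i₀ + k + 2) > n, so the greedy choice
      -- cannot exhaust them.
      have hlt : n < ∑ t ∈ A, t + b ^ (i₀ + k + 1) := by
        refine hor.resolve_right fun h => ?_
        rw [hcard, ← pow_add, show 2 + (i₀ + k) = i₀ + 1 + (k + 1) by ring] at h
        omega
      obtain ⟨s, hs, hsle, hslt⟩ := ih (n - ∑ t ∈ A, t) (by
        rw [show i₀ + 1 + k = i₀ + k + 1 by ring]; omega)
      have hAmem : ∑ t ∈ A, t ∈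
          distinctSums (F ∩ {t | b ^ (i₀ + k) ≤ t ∧ t < b ^ (i₀ + k + 1)}) :=
        ⟨A, fun t ht => ⟨hLF (hA ht), hL t (hA ht)⟩, rfl⟩
      have hdisj : Disjoint (F ∩ {t | b ^ (i₀ + k) ≤ t ∧ t < b ^ (i₀ + k + 1)})
          (F ∩ {t | t < b ^ (i₀ + k)}) := by
        rw [Set.disjoint_left]
        rintro t ⟨-, h1, -⟩ ⟨-, h2⟩
        exact absurd h2 (not_lt.2 h1)
      refine ⟨_, distinctSums_mono ?_ (add_mem_distinctSums hdisj hAmem hs), by omega, by omega⟩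
      rintro t (⟨h1, -, h2⟩ | ⟨h1, h2⟩)
      · exact ⟨h1, h2⟩
      · exact ⟨h1, lt_of_lt_of_le h2 (Nat.pow_le_pow_right (by omega) (by omega))⟩
  refine ⟨b ^ (i₀ + 1), by positivity, fun n => ?_⟩
  have hn : n < b ^ (i₀ + 1 + n) :=
    (Nat.lt_pow_self hb).trans_le (Nat.pow_le_pow_right (by omega) (by omega))
  obtain ⟨s, hs, h⟩ := key n n hn
  exact ⟨s, distinctSums_mono Set.inter_subset_left hs, h⟩

/-- The products `p ^ α * q ^ β` with `β < p ^ 2`. -/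
def strip (p q : ℕ) : Set ℕ := {t | ∃ α β, β < p ^ 2 ∧ t = p ^ α * q ^ β}

/-- For each β < p², one power of p moves q ^ β into [p ^ i, p ^ (i + 1)) once i is large; this
supplies the p² elements per level. -/
theorem exists_gap_strip {p q : ℕ} (hp : 1 < p) (hq : 1 < q) (h : Nat.Coprime p q) :
    ∃ G, 0 < G ∧ ∀ n, ∃ s ∈ distinctSums (strip p q), s ≤ n ∧ n < s + G := by
  refine exists_gap_of_dense_levels (i₀ := Nat.log p (q ^ p ^ 2)) hp fun i hi => ?_
  refine ⟨(Finset.range (p ^ 2)).image fun β => p ^ (i - Nat.log p (q ^ β)) * q ^ β, ?_, ?_, ?_⟩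
  · intro t ht
    simp only [Finset.coe_image, Set.mem_image, Finset.coe_range, Set.mem_Iio] at ht
    obtain ⟨β, hβ, rfl⟩ := ht
    exact ⟨_, β, hβ, rfl⟩
  · rw [Finset.card_image_of_injective, Finset.card_range]
    exact fun x y hxy => (pow_mul_pow_inj hp hq h hxy).2
  · intro t ht
    obtain ⟨β, hβ, rfl⟩ := Finset.mem_image.1 ht
    have hle : Nat.log p (q ^ β) ≤ i :=
      (Nat.log_mono_right (Nat.pow_le_pow_right (by omega) (Finset.mem_range.1 hβ).le)).trans hi
    have h1 : p ^ Nat.log p (q ^ β) ≤ q ^ β := Nat.pow_log_le_self p (by positivity)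
    have h2 : q ^ β < p ^ (Nat.log p (q ^ β) + 1) := Nat.lt_pow_succ_log_self hp _
    have h3 : 0 < p ^ (i - Nat.log p (q ^ β)) := by positivity
    constructor
    · calc p ^ i = p ^ (i - Nat.log p (q ^ β)) * p ^ Nat.log p (q ^ β) := by
            rw [← pow_add, Nat.sub_add_cancel hle]
        _ ≤ _ := Nat.mul_le_mul_left _ h1
    · calc _ < p ^ (i - Nat.log p (q ^ β)) * p ^ (Nat.log p (q ^ β) + 1) :=
            Nat.mul_lt_mul_of_pos_left h2 h3
        _ = p ^ (i + 1) := by rw [← pow_add, ← add_assoc, Nat.sub_add_cancel hle]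

/-! ### Pairs of sums with bounded difference -/

theorem injective_of_mem_blocks {g : ℕ} {u : ℕ → ℕ} (hle : ∀ i, u i ≤ g * i + (g - 1))
    (hlt : ∀ i, g * i + (g - 1) < u i + g) : Function.Injective u := by
  intro i j hij
  have h1 := hle i
  have h2 := hlt i
  have h3 := hle j
  have h4 := hlt j
  by_contra hne
  rcases Nat.lt_or_gt_of_ne hne with h | h
  all_goals
    have := Nat.mul_le_mul_left g (Nat.succ_le_of_lt h)
    rw [Nat.mul_succ] at this
    omega

/-- If `S` and `T` have gaps at most `g` and `P`, `Q` are coprime, then among the numbers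
`P * s + Q * t` there are two distinct ones at distance less than `16 * g ^ 2`. -/
theorem exists_close_combinations {S T : Set ℕ} {g P Q : ℕ} (hg : 0 < g)
    (hS : ∀ n, ∃ s ∈ S, s ≤ n ∧ n < s + g) (hT : ∀ n, ∃ t ∈ T, t ≤ n ∧ n < t + g)
    (hPQ : Nat.Coprime P Q) (hP : 3 * g ≤ P) (hQ : 3 * g ≤ Q) :
    ∃ s ∈ S, ∃ t ∈ T, ∃ s' ∈ S, ∃ t' ∈ T, P * s + Q * t < P * s' + Q * t' ∧
      P * s' + Q * t' < P * s + Q * t + 16 * g ^ 2 := by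
  choose u huS hule hult using fun i : ℕ => hS (g * i + (g - 1))
  choose v hvT hvle hvlt using fun i : ℕ => hT (g * i + (g - 1))
  have huinj := injective_of_mem_blocks hule hult
  have hvinj := injective_of_mem_blocks hvle hvlt
  have huQ : ∀ i < Q / g, u i < Q := by
    intro i hi
    have h1 := Nat.mul_le_mul_left g (Nat.succ_le_of_lt hi)
    have h2 := Nat.mul_div_le Q g
    have h3 := hule i
    rw [Nat.mul_succ] at h1
    omega
  have hvP : ∀ i < P / g, v i < P := by
    intro i hi
    have h1 := Nat.mul_le_mul_left g (Nat.succ_le_of_lt hi)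
    have h2 := Nat.mul_div_le P g
    have h3 := hvle i
    rw [Nat.mul_succ] at h1
    omega
  have hP0 : 0 < P := by omega
  have hQ0 : 0 < Q := by omega
  have hI : 3 ≤ Q / g := (Nat.le_div_iff_mul_le hg).2 hQ
  have hJ : 3 ≤ P / g := (Nat.le_div_iff_mul_le hg).2 hP
  have hQI : Q ≤ 2 * g * (Q / g) := by
    have := Nat.lt_mul_div_succ Q hg
    nlinarith
  have hPJ : P ≤ 2 * g * (P / g) := by
    have := Nat.lt_mul_div_succ P hg
    nlinarith
  have hg2 : 0 < 16 * g ^ 2 := by positivity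
  -- Pigeonhole: the sums are at most 2PQ ≤ 8g²(Q/g)(P/g), so cells of length 16g² number at most
  -- half the pairs plus one.
  obtain ⟨x, hx, y, hy, hne, heq⟩ := Finset.exists_ne_map_eq_of_card_lt_of_maps_to
    (s := Finset.range (Q / g) ×ˢ Finset.range (P / g))
    (t := Finset.range (2 * (P * Q) / (16 * g ^ 2) + 1))
    (f := fun x => (P * u x.1 + Q * v x.2) / (16 * g ^ 2))
    (by
      rw [Finset.card_range, Finset.card_product, Finset.card_range, Finset.card_range]
      have h1 : 2 * (P * Q) ≤ 16 * g ^ 2 * (Q / g * (P / g)) / 2 := by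
        rw [Nat.le_div_iff_mul_le two_pos]
        nlinarith [Nat.mul_le_mul hPJ hQI]
      have h2 : 2 * (2 * (P * Q) / (16 * g ^ 2)) ≤ Q / g * (P / g) := by
        have h3 := Nat.mul_div_le (2 * (P * Q)) (16 * g ^ 2)
        refine Nat.le_of_mul_le_mul_left ?_ hg2
        rw [Nat.le_div_iff_mul_le two_pos] at h1
        nlinarith
      have h4 : 9 ≤ Q / g * (P / g) := Nat.mul_le_mul hI hJ
      omega)
    (by
      intro x hx
      simp only [Finset.coe_product, Finset.coe_range, Set.mem_prod, Set.mem_Iio] at hx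
      simp only [Finset.coe_range, Set.mem_Iio]
      refine Nat.lt_succ_of_le (Nat.div_le_div_right ?_)
      have h1 := Nat.mul_le_mul_left P (huQ _ hx.1).le
      have h2 := Nat.mul_le_mul_left Q (hvP _ hx.2).le
      rw [Nat.mul_comm Q P] at h2
      omega)
  simp only [Finset.mem_product, Finset.mem_range] at hx hy
  -- Since u < Q, the sum modulo Q determines u, and then v.
  have hsum : P * u x.1 + Q * v x.2 ≠ P * u y.1 + Q * v y.2 := by
    intro h
    have hmod : P * u x.1 ≡ P * u y.1 [MOD Q] := by
      have : P * u x.1 + Q * v x.2 ≡ P * u y.1 + Q * v y.2 [MOD Q] := by rw [h]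
      simpa [Nat.ModEq] using this
    have h1 := Nat.ModEq.cancel_left_of_coprime (by rwa [Nat.coprime_comm] at hPQ) hmod
    have h2 : u x.1 = u y.1 := h1.eq_of_lt_of_lt (huQ _ hx.1) (huQ _ hy.1)
    rw [h2] at h
    have h3 : v x.2 = v y.2 := Nat.eq_of_mul_eq_mul_left hQ0 (Nat.add_left_cancel h)
    exact hne (Prod.ext (huinj h2) (hvinj h3))
  have close : ∀ m n c : ℕ, 0 < c → m / c = n / c → n < m + c := by
    intro m n c hc h
    have h1 := Nat.lt_mul_div_succ n hc
    have h2 := Nat.mul_div_le m c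
    rw [← h, Nat.mul_succ] at h1
    omega
  rcases Nat.lt_or_gt_of_ne hsum with h | h
  · exact ⟨_, huS x.1, _, hvT x.2, _, huS y.1, _, hvT y.2, h, close _ _ _ hg2 heq⟩
  · exact ⟨_, huS y.1, _, hvT y.2, _, huS x.1, _, hvT x.2, h, close _ _ _ hg2 heq.symm⟩

/-- The products `p ^ α * q ^ β` with `α < q ^ 2` or `β < p ^ 2`. -/
def cross (p q : ℕ) : Set ℕ := {t | ∃ α β, (α < q ^ 2 ∨ β < p ^ 2) ∧ t = p ^ α * q ^ β}

theorem exists_bounded_difference {p q : ℕ} (hp : 1 < p) (hq : 1 < q) (h : Nat.Coprime p q) :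
    ∃ C, ∀ N, ∃ x, ∃ d ∈ Finset.Ico 1 C, x ∈ distinctSums (cross p q ∩ {t | N < t}) ∧
      x + d ∈ distinctSums (cross p q ∩ {t | N < t}) := by
  obtain ⟨g₁, hg₁, h₁⟩ := exists_gap_strip hp hq h
  obtain ⟨g₂, hg₂, h₂⟩ := exists_gap_strip hq hp h.symm
  refine ⟨16 * (g₁ + g₂) ^ 2, fun N => ?_⟩
  -- N makes all terms large, q² separates the two scaled strips by their p-exponents, and the last
  -- summand meets the size condition of the pigeonhole.
  set a := N + q ^ 2 + 3 * (g₁ + g₂) with ha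
  have hpa : a < p ^ a := Nat.lt_pow_self hp
  have hqa : a < q ^ a := Nat.lt_pow_self hq
  obtain ⟨s, hs, t, ht, s', hs', t', ht', hlt, hlt'⟩ :=
    exists_close_combinations (g := g₁ + g₂) (P := p ^ a) (Q := q ^ a) (by omega)
      (fun n => by obtain ⟨s, hs, h1, h2⟩ := h₁ n; exact ⟨s, hs, h1, by omega⟩)
      (fun n => by obtain ⟨s, hs, h1, h2⟩ := h₂ n; exact ⟨s, hs, h1, by omega⟩)
      (Nat.Coprime.pow _ _ h) (by omega) (by omega)
  have hdisj : Disjoint ((p ^ a * ·) '' strip p q) ((q ^ a * ·) '' strip q p) := by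
    rw [Set.disjoint_left]
    rintro _ ⟨_, ⟨α, β, hβ, rfl⟩, rfl⟩ ⟨_, ⟨α', β', hβ', rfl⟩, heq⟩
    have := (pow_mul_pow_inj (a := a + α) (b := β) (c := β') (d := a + α') hp hq h (by
      rw [pow_add p a, mul_assoc, ← show q ^ a * (q ^ α' * p ^ β') = p ^ a * (p ^ α * q ^ β) from heq,
        pow_add]
      ring)).1
    omega
  have hsub : (p ^ a * ·) '' strip p q ∪ (q ^ a * ·) '' strip q p ⊆
      cross p q ∩ {t | N < t} := by
    rintro _ (⟨_, ⟨α, β, hβ, rfl⟩, rfl⟩ | ⟨_, ⟨α, β, hβ, rfl⟩, rfl⟩)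
    · refine ⟨⟨a + α, β, Or.inr hβ, by simp only [pow_add, mul_assoc]⟩, ?_⟩
      have : 0 < p ^ α * q ^ β := by positivity
      show N < p ^ a * (p ^ α * q ^ β)
      nlinarith
    · refine ⟨⟨β, a + α, Or.inl hβ, by simp only [pow_add]; ring⟩, ?_⟩
      have : 0 < q ^ α * p ^ β := by positivity
      show N < q ^ a * (q ^ α * p ^ β)
      nlinarith
  have hmem : ∀ {s t}, s ∈ distinctSums (strip p q) → t ∈ distinctSums (strip q p) →
      p ^ a * s + q ^ a * t ∈ distinctSums (cross p q ∩ {t | N < t}) := fun hs ht =>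
    distinctSums_mono hsub (add_mem_distinctSums hdisj (mul_mem_distinctSums (by omega) hs)
      (mul_mem_distinctSums (by omega) ht))
  refine ⟨_, p ^ a * s' + q ^ a * t' - (p ^ a * s + q ^ a * t), ?_, hmem hs ht, ?_⟩
  · rw [Finset.mem_Ico]
    omega
  · rw [Nat.add_sub_cancel' hlt.le]
    exact hmem hs' ht'

/-- Only finitely many differences are available, and pairs above a higher threshold also serve a
lower one. -/
theorem exists_common_difference {p q : ℕ} (hp : 1 < p) (hq : 1 < q) (h : Nat.Coprime p q) :
    ∃ D, 0 < D ∧ ∀ N, ∃ x, x ∈ distinctSums (cross p q ∩ {t | N < t}) ∧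
      x + D ∈ distinctSums (cross p q ∩ {t | N < t}) := by
  obtain ⟨C, hC⟩ := exists_bounded_difference hp hq h
  by_contra! hcon
  choose! M hM using hcon
  obtain ⟨x, d, hd, hx, hxd⟩ := hC (∑ d ∈ Finset.Ico 1 C, M d)
  have hle : M d ≤ ∑ d ∈ Finset.Ico 1 C, M d :=
    Finset.single_le_sum (f := M) (fun _ _ => Nat.zero_le _) hd
  have hsub : cross p q ∩ {t | ∑ d ∈ Finset.Ico 1 C, M d < t} ⊆ cross p q ∩ {t | M d < t} :=
    fun t ht => ⟨ht.1, lt_of_le_of_lt hle ht.2⟩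
  exact hM d (Finset.mem_Ico.1 hd).1 x (distinctSums_mono hsub hx) (distinctSums_mono hsub hxd)

theorem exists_progression {X : Set ℕ} {D : ℕ}
    (hD : ∀ N, ∃ x, x ∈ distinctSums (X ∩ {t | N < t}) ∧
      x + D ∈ distinctSums (X ∩ {t | N < t})) (N R : ℕ) :
    ∃ Y, ∀ r ≤ R, Y + r * D ∈ distinctSums (X ∩ {t | N < t}) := by
  induction R with
  | zero => exact ⟨0, fun r hr => by simpa [Nat.le_zero.1 hr] using zero_mem_distinctSums _⟩
  | succ R ih =>
    obtain ⟨Y, hY⟩ := ih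
    -- The new pair uses only terms exceeding every earlier sum, so it is disjoint from them; its
    -- two choices lengthen the progression by one.
    obtain ⟨x, hx, hxD⟩ := hD (N + (Y + R * D))
    have hsum : ∀ r ≤ R, ∀ z ∈ distinctSums (X ∩ {t | N + (Y + R * D) < t}),
        Y + r * D + z ∈ distinctSums (X ∩ {t | N < t}) := by
      intro r hr z hz
      have h1 := mem_distinctSums_of_le (hY r hr)
        (Nat.add_le_add_left (Nat.mul_le_mul_right D hr) Y)
      refine distinctSums_mono ?_ (add_mem_distinctSums ?_ h1 hz)
      · rintro t (⟨ht, -⟩ | ⟨ht, ht'⟩)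
        · exact ht
        · exact ⟨ht, lt_of_le_of_lt (Nat.le_add_right _ _) ht'⟩
      · rw [Set.disjoint_left]
        rintro t ⟨-, (h2 : t ≤ _)⟩ ⟨-, (h3 : _ < t)⟩
        omega
    refine ⟨Y + x, fun r hr => ?_⟩
    rcases Nat.lt_or_ge R r with hlt | hle
    · obtain rfl : r = R + 1 := by omega
      have := hsum R le_rfl _ hxD
      rwa [show Y + x + (R + 1) * D = Y + R * D + (x + D) by ring]
    · have := hsum r hle _ hx
      rwa [show Y + x + r * D = Y + r * D + x by ring]

/-! ### Residues -/

/-- For every base `p > 1` some power `p ^ A` has all its multiples represented modulo `D` by sums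
of distinct powers `p ^ α` with `α > 0`. -/
theorem exists_pow_multiples {p D : ℕ} (hp : 1 < p) (hD : 0 < D) :
    ∃ A, ∀ k : ℕ, ∃ x ∈ distinctSums {t | ∃ α, 0 < α ∧ t = p ^ α},
      x ≡ k * p ^ A [MOD D] := by
  have : NeZero D := ⟨hD.ne'⟩
  -- Infinitely many powers share one residue c, so k of them sum to k * c.
  obtain ⟨c, hc⟩ := Finite.exists_infinite_fiber fun α : ℕ => ((p : ZMod D) ^ (α + 1))
  have hinf : ((fun α : ℕ => ((p : ZMod D) ^ (α + 1))) ⁻¹' {c}).Infinite :=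
    Set.infinite_coe_iff.1 hc
  obtain ⟨A, hA⟩ := hinf.nonempty
  refine ⟨A + 1, fun k => ?_⟩
  obtain ⟨B, hB, hcard⟩ := hinf.exists_subset_card_eq k
  have hinj : Function.Injective fun α : ℕ => p ^ (α + 1) := fun x y hxy => by
    have := Nat.pow_right_injective hp hxy
    omega
  refine ⟨_, ⟨B.image fun α => p ^ (α + 1), ?_, rfl⟩, ?_⟩
  · intro t ht
    obtain ⟨α, -, rfl⟩ := Finset.mem_image.1 (Finset.mem_coe.1 ht)
    exact ⟨α + 1, by omega, rfl⟩
  · rw [← ZMod.natCast_eq_natCast_iff, Finset.sum_image hinj.injOn]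
    push_cast
    have hA' : (p : ZMod D) ^ (A + 1) = c := hA
    rw [Finset.sum_congr rfl fun α hα => (show (p : ZMod D) ^ (α + 1) = c from hB hα), hA']
    simp [hcard]

theorem exists_residues {p q D : ℕ} (hp : 1 < p) (hq : 1 < q) (h : Nat.Coprime p q)
    (hD : 0 < D) : ∃ e, ∀ r, ∃ x ∈ distinctSums (cross p q ∩ {t | t ≤ e}),
      x ≤ e ∧ x ≡ r [MOD D] := by
  have : NeZero D := ⟨hD.ne'⟩
  obtain ⟨A, hA⟩ := exists_pow_multiples hp hD
  obtain ⟨B, hB⟩ := exists_pow_multiples hq hD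
  -- Positive exponents exclude the common element 1.
  have hdisj : Disjoint {t | ∃ α, 0 < α ∧ t = p ^ α} {t | ∃ α, 0 < α ∧ t = q ^ α} := by
    rw [Set.disjoint_left]
    rintro _ ⟨α, hα, rfl⟩ ⟨β, hβ, heq⟩
    have := (pow_mul_pow_inj (a := α) (b := 0) (c := 0) (d := β) hp hq h (by simpa using heq)).1
    omega
  have hsub : {t | ∃ α, 0 < α ∧ t = p ^ α} ∪ {t | ∃ α, 0 < α ∧ t = q ^ α} ⊆ cross p q := by
    rintro _ (⟨α, -, rfl⟩ | ⟨α, -, rfl⟩)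
    · exact ⟨α, 0, Or.inr (by positivity), by simp⟩
    · exact ⟨0, α, Or.inl (by positivity), by simp⟩
  have hres : ∀ r : ℕ, ∃ x ∈ distinctSums (cross p q), x ≡ r [MOD D] := by
    intro r
    have hbez : IsCoprime ((p ^ A : ℕ) : ℤ) ((q ^ B : ℕ) : ℤ) :=
      Nat.isCoprime_iff_coprime.2 (Nat.Coprime.pow A B h)
    obtain ⟨u, v, huv⟩ := hbez
    obtain ⟨x, hx, hxr⟩ := hA ((r * u : ℤ) : ZMod D).val
    obtain ⟨y, hy, hyr⟩ := hB ((r * v : ℤ) : ZMod D).val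
    refine ⟨x + y, distinctSums_mono hsub (add_mem_distinctSums hdisj hx hy), ?_⟩
    refine (hxr.add hyr).trans ?_
    rw [← ZMod.natCast_eq_natCast_iff]
    have huv' := congrArg (Int.cast : ℤ → ZMod D) huv
    push_cast at huv' ⊢
    simp only [ZMod.natCast_val, ZMod.cast_id', id_eq]
    linear_combination (r : ZMod D) * huv'
  choose x hx hxr using hres
  refine ⟨∑ r ∈ Finset.range D, x r, fun r => ?_⟩
  have hle : x (r % D) ≤ ∑ r ∈ Finset.range D, x r :=
    Finset.single_le_sum (f := x) (fun _ _ => Nat.zero_le _)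
      (Finset.mem_range.2 (Nat.mod_lt r hD))
  exact ⟨x (r % D), mem_distinctSums_of_le (hx _) hle, hle,
    (hxr (r % D)).trans (Nat.mod_modEq r D)⟩

/-- Every sufficiently large integer is a sum of distinct `p ^ α * q ^ β`, where moreover one of
the exponents stays bounded. -/
theorem exists_complete_of_bounded_exponent {p q : ℕ} (hp : 1 < p) (hq : 1 < q)
    (h : Nat.Coprime p q) : ∃ K n₀, ∀ n, n₀ ≤ n →
      n ∈ distinctSums {t | ∃ α β, (α < K ∨ β < K) ∧ t = p ^ α * q ^ β} := by
  obtain ⟨g, hg, hgap⟩ := exists_gap_strip hp hq h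
  obtain ⟨D, hD, hDx⟩ := exists_common_difference hp hq h
  obtain ⟨e, he⟩ := exists_residues hp hq h hD
  -- Scaling by M moves the strip off `cross p q` while its q-exponents stay below 2p².
  set M := p ^ q ^ 2 * q ^ p ^ 2 with hM
  have hM0 : 0 < M := by positivity
  -- Terms above e avoid those of the residue sums; the length covers the error M * g left by the
  -- scaled strip.
  obtain ⟨Y, hY⟩ := exists_progression hDx e (e + M * g)
  refine ⟨q ^ 2 + 2 * p ^ 2, Y + e, fun n hn => ?_⟩
  obtain ⟨s, hs, hsle, hslt⟩ := hgap ((n - Y - e) / M)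
  have hs1 : M * s ≤ n - Y - e := (Nat.mul_le_mul_left M hsle).trans (Nat.mul_div_le _ _)
  have hs2 : n - Y - e < M * s + M * g := by
    rw [← Nat.mul_add]
    exact (Nat.lt_mul_div_succ _ hM0).trans_le (Nat.mul_le_mul_left M hslt)
  obtain ⟨x, hx, hxe, hxr⟩ := he (n - Y - M * s)
  obtain ⟨k, hk⟩ := (Nat.modEq_iff_dvd' (by omega)).1 hxr
  have hkle : k ≤ e + M * g := by
    have : k ≤ D * k := Nat.le_mul_of_pos_left k hD
    omega
  have hcross : Y + k * D + x ∈ distinctSums (cross p q) := by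
    refine distinctSums_mono ?_ (add_mem_distinctSums ?_ (hY k hkle) hx)
    · exact Set.union_subset Set.inter_subset_left Set.inter_subset_left
    · rw [Set.disjoint_left]
      rintro t ⟨-, (h1 : e < t)⟩ ⟨-, (h2 : t ≤ e)⟩
      omega
  have hdisj : Disjoint (cross p q) ((M * ·) '' strip p q) := by
    rw [Set.disjoint_left]
    rintro _ ⟨α, β, hor, rfl⟩ ⟨_, ⟨α', β', hβ', rfl⟩, heq⟩
    have := pow_mul_pow_inj (a := q ^ 2 + α') (b := p ^ 2 + β') (c := α) (d := β) hp hq h (by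
      rw [pow_add, pow_add, ← heq, hM]
      ring)
    omega
  have hn' : n = Y + k * D + x + M * s := by
    rw [Nat.mul_comm k D, ← hk]
    omega
  rw [hn']
  refine distinctSums_mono ?_ (add_mem_distinctSums hdisj hcross (mul_mem_distinctSums hM0 hs))
  rintro _ (⟨α, β, hor, rfl⟩ | ⟨_, ⟨α, β, hβ, rfl⟩, rfl⟩)
  · exact ⟨α, β, by omega, rfl⟩
  · exact ⟨q ^ 2 + α, p ^ 2 + β, by omega, by simp only [hM, pow_add]; ring⟩

open Filter Topology

/-! ### Lattice points in a triangle -/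

/-- The lattice points `(β, α)` with `β * b + α * a ≤ Z`. -/
noncomputable def latticeTriangle (a b Z : ℝ) : Finset (Σ _ : ℕ, ℕ) :=
  (Finset.range (⌊Z / b⌋₊ + 1)).sigma fun β => Finset.range (⌊(Z - β * b) / a⌋₊ + 1)

theorem mem_latticeTriangle {a b Z : ℝ} (ha : 0 < a) (hb : 0 < b) (hZ : 0 ≤ Z)
    {x : Σ _ : ℕ, ℕ} : x ∈ latticeTriangle a b Z ↔ x.1 * b + x.2 * a ≤ Z := by
  rw [latticeTriangle, Finset.mem_sigma, Finset.mem_range, Finset.mem_range, Nat.lt_succ_iff,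
    Nat.lt_succ_iff, Nat.le_floor_iff (by positivity), le_div_iff₀ hb]
  constructor
  · rintro ⟨h1, h2⟩
    rw [Nat.le_floor_iff (div_nonneg (by linarith) ha.le), le_div_iff₀ ha] at h2
    linarith
  · intro h
    have h2 : 0 ≤ (x.2 : ℝ) * a := by positivity
    refine ⟨by linarith, ?_⟩
    rw [Nat.le_floor_iff (div_nonneg (by linarith) ha.le), le_div_iff₀ ha]
    linarith

theorem sum_range_sub_mul_div (a b Z : ℝ) (B : ℕ) :
    ∑ β ∈ Finset.range (B + 1), (Z - β * b) / a = (B + 1) * (Z - b * B / 2) / a := by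
  induction B with
  | zero => simp
  | succ B ih =>
    rw [Finset.sum_range_succ, ih]
    push_cast
    ring

theorem le_card_latticeTriangle {a b Z : ℝ} (ha : 0 < a) (hb : 0 < b) (hZ : 0 ≤ Z) :
    Z ^ 2 / (2 * a * b) ≤ (latticeTriangle a b Z).card := by
  have h1 : ∑ β ∈ Finset.range (⌊Z / b⌋₊ + 1), (Z - β * b) / a ≤
      (latticeTriangle a b Z).card := by
    rw [latticeTriangle, Finset.card_sigma]
    push_cast
    refine Finset.sum_le_sum fun β _ => ?_
    rw [Finset.card_range]
    push_cast
    exact (Nat.lt_floor_add_one _).le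
  refine le_trans ?_ h1
  rw [sum_range_sub_mul_div]
  have h2 : (⌊Z / b⌋₊ : ℝ) * b ≤ Z := (le_div_iff₀ hb).1 (Nat.floor_le (by positivity))
  have h3 : Z < (⌊Z / b⌋₊ + 1) * b := (div_lt_iff₀ hb).1 (Nat.lt_floor_add_one _)
  rw [div_le_div_iff₀ (by positivity) ha]
  have h4 : Z * (Z / 2) ≤ (⌊Z / b⌋₊ + 1) * b * (Z - b * ⌊Z / b⌋₊ / 2) :=
    mul_le_mul h3.le (by linarith) (by linarith) (by positivity)
  nlinarith

theorem card_latticeTriangle_le {a b Z : ℝ} (ha : 0 < a) (hb : 0 < b) (hZ : 0 ≤ Z) :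
    ((latticeTriangle a b Z).card : ℝ) ≤ (Z + a + b) ^ 2 / (2 * a * b) := by
  have h1 : ((latticeTriangle a b Z).card : ℝ) ≤
      ∑ β ∈ Finset.range (⌊Z / b⌋₊ + 1), (Z + a - β * b) / a := by
    rw [latticeTriangle, Finset.card_sigma]
    push_cast
    refine Finset.sum_le_sum fun β hβ => ?_
    have h2 : (β : ℝ) ≤ Z / b :=
      (Nat.le_floor_iff (by positivity)).1 (Nat.lt_succ_iff.1 (Finset.mem_range.1 hβ))
    rw [le_div_iff₀ hb] at h2
    have h3 : (⌊(Z - β * b) / a⌋₊ : ℝ) ≤ (Z - β * b) / a :=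
      Nat.floor_le (div_nonneg (by linarith) ha.le)
    rw [Finset.card_range]
    push_cast
    have h4 : (Z + a - β * b) / a = (Z - β * b) / a + 1 := by
      field_simp
      ring
    linarith
  refine h1.trans ?_
  rw [sum_range_sub_mul_div, div_le_div_iff₀ ha (by positivity)]
  set B : ℝ := (⌊Z / b⌋₊ : ℝ)
  -- With y = b(B + 1) the left side is y(2Z + 2a + b - y), at most (Z + a + b/2)².
  have h5 : 2 * (b * (B + 1)) * (Z + a - b * B / 2) ≤ (Z + a + b) ^ 2 := by
    nlinarith [sq_nonneg (Z + a - b * B - b / 2), mul_nonneg hZ hb.le, mul_pos ha hb]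
  calc _ = a * (2 * (b * (B + 1)) * (Z + a - b * B / 2)) := by ring
    _ ≤ a * (Z + a + b) ^ 2 := mul_le_mul_of_nonneg_left h5 ha.le
    _ = _ := by ring

/-! ### Bounds for the number of expressions -/

theorem log_pow_mul_pow {p q : ℕ} (hp : 1 < p) (hq : 1 < q) (α β : ℕ) :
    Real.log ((p ^ α * q ^ β : ℕ) : ℝ) = β * Real.log q + α * Real.log p := by
  have h1 : (p : ℝ) ≠ 0 := by positivity
  have h2 : (q : ℝ) ≠ 0 := by positivity
  push_cast
  rw [Real.log_mul (pow_ne_zero _ h1) (pow_ne_zero _ h2), Real.log_pow, Real.log_pow]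
  ring

theorem numExpressions_le {p q : ℕ} (hp : 1 < p) (hq : 1 < q) (n : ℕ) :
    numExpressions p q n ≤
      2 ^ (latticeTriangle (Real.log p) (Real.log q) (Real.log n)).card := by
  have ha : 0 < Real.log p := Real.log_pos (by exact_mod_cast hp)
  have hb : 0 < Real.log q := Real.log_pos (by exact_mod_cast hq)
  set T := (latticeTriangle (Real.log p) (Real.log q) (Real.log n)).image
    fun x => p ^ x.2 * q ^ x.1 with hT
  have hsub : expressions p q n ⊆ (T.powerset : Set (Finset ℕ)) := by
    rintro S ⟨hS, hsum⟩
    rw [Finset.mem_coe, Finset.mem_powerset]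
    intro m hm
    obtain ⟨α, β, rfl⟩ := hS m hm
    have hle : p ^ α * q ^ β ≤ n :=
      (Finset.single_le_sum (f := fun k => k) (fun _ _ => Nat.zero_le _) hm).trans hsum.le
    have hpos : 0 < p ^ α * q ^ β := by positivity
    refine Finset.mem_image.2 ⟨⟨β, α⟩, ?_, rfl⟩
    rw [mem_latticeTriangle ha hb (Real.log_natCast_nonneg n), ← log_pow_mul_pow hp hq]
    exact Real.log_le_log (by exact_mod_cast hpos) (by exact_mod_cast hle)
  calc numExpressions p q n ≤ (T.powerset : Set (Finset ℕ)).ncard :=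
        Set.ncard_le_ncard hsub T.powerset.finite_toSet
    _ = 2 ^ T.card := by rw [Set.ncard_coe_finset, Finset.card_powerset]
    _ ≤ _ := Nat.pow_le_pow_right two_pos Finset.card_image_le

/-- If `T` consists of power products outside `R`, and all numbers in `[n - ∑ T, n]` are sums of
distinct power products from `R`, then each subset of `T` extends to an expression of `n`. -/
theorem two_pow_card_le_numExpressions {p q n n₀ : ℕ} {R : Set ℕ} {T : Finset ℕ}
    (hR : R ⊆ powerProducts p q) (hT : ↑T ⊆ powerProducts p q) (hdisj : Disjoint (↑T) R)
    (hcomplete : ∀ m, n₀ ≤ m → m ∈ distinctSums R) (hn : ∑ t ∈ T, t + n₀ ≤ n) :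
    2 ^ T.card ≤ numExpressions p q n := by
  have hext : ∀ B : Finset ℕ, ∃ A : Finset ℕ, ↑A ⊆ R ∧
      (B ⊆ T → ∑ m ∈ A, m + ∑ t ∈ B, t = n) := by
    intro B
    by_cases hB : B ⊆ T
    · have hle : ∑ t ∈ B, t ≤ ∑ t ∈ T, t := Finset.sum_le_sum_of_subset hB
      obtain ⟨A, hA, hs⟩ := hcomplete (n - ∑ t ∈ B, t) (by omega)
      exact ⟨A, hA, fun _ => by omega⟩
    · exact ⟨∅, by simp, fun h => absurd h hB⟩
  choose A hAR hA using hext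
  have hnot : ∀ B, ∀ t ∈ T, t ∉ A B := fun B t ht htA =>
    Set.disjoint_left.1 hdisj (Finset.mem_coe.2 ht) (hAR B (Finset.mem_coe.2 htA))
  rw [← Finset.card_powerset, ← Set.ncard_coe_finset]
  -- B is recovered as the part of the expression inside T.
  refine Set.ncard_le_ncard_of_injOn (fun B => A B ∪ B) ?_ ?_ (expressions_finite p q n)
  · intro B hB
    rw [Finset.mem_coe, Finset.mem_powerset] at hB
    refine ⟨fun m hm => ?_, ?_⟩
    · rcases Finset.mem_union.1 hm with hm | hm
      · exact hR (hAR B (Finset.mem_coe.2 hm))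
      · exact hT (Finset.mem_coe.2 (hB hm))
    · rw [Finset.sum_union, hA B hB]
      exact Finset.disjoint_left.2 fun t htA htB => hnot B t (hB htB) htA
  · intro B hB B' hB' heq
    rw [Finset.mem_coe, Finset.mem_powerset] at hB hB'
    ext t
    have hiff : t ∈ A B ∪ B ↔ t ∈ A B' ∪ B' := by
      rw [show A B ∪ B = A B' ∪ B' from heq]
    rw [Finset.mem_union, Finset.mem_union] at hiff
    constructor
    · exact fun ht => (hiff.1 (Or.inr ht)).resolve_left (hnot B' t (hB ht))
    · exact fun ht => (hiff.2 (Or.inr ht)).resolve_left (hnot B t (hB' ht))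

/-- The triangle is shifted by (K, K) to avoid the sparse set; the sum of its terms is bounded by
their number times the largest possible term. -/
theorem exists_le_numExpressions {p q : ℕ} (hp : 1 < p) (hq : 1 < q) (h : Nat.Coprime p q) :
    ∃ (c : ℝ) (n₀ : ℕ), ∀ (n : ℕ) (Z : ℝ), 0 ≤ Z →
      c * (Z + Real.log p + Real.log q) ^ 2 * Real.exp Z + n₀ ≤ n →
      2 ^ (latticeTriangle (Real.log p) (Real.log q) Z).card ≤ numExpressions p q n := by
  have ha : 0 < Real.log p := Real.log_pos (by exact_mod_cast hp)
  have hb : 0 < Real.log q := Real.log_pos (by exact_mod_cast hq)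
  obtain ⟨K, n₀, hcomplete⟩ := exists_complete_of_bounded_exponent hp hq h
  refine ⟨(p ^ K * q ^ K : ℕ) / (2 * Real.log p * Real.log q), n₀, fun n Z hZ hn => ?_⟩
  set τ : (Σ _ : ℕ, ℕ) → ℕ := fun x => p ^ (K + x.2) * q ^ (K + x.1) with hτ
  have hinj : Function.Injective τ := by
    rintro ⟨β, α⟩ ⟨β', α'⟩ heq
    obtain ⟨h1, h2⟩ := pow_mul_pow_inj hp hq h heq
    obtain rfl : β = β' := by simpa using h2
    obtain rfl : α = α' := by simpa using h1
    rfl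
  rw [← Finset.card_image_of_injective _ hinj]
  refine two_pow_card_le_numExpressions (n₀ := n₀)
    (R := {t | ∃ α β, (α < K ∨ β < K) ∧ t = p ^ α * q ^ β}) ?_ ?_ ?_ hcomplete ?_
  · rintro _ ⟨α, β, -, rfl⟩
    exact ⟨α, β, rfl⟩
  · intro t ht
    obtain ⟨x, -, rfl⟩ := Finset.mem_image.1 (Finset.mem_coe.1 ht)
    exact ⟨_, _, rfl⟩
  · rw [Set.disjoint_left]
    rintro t ht ⟨α, β, hor, rfl⟩
    obtain ⟨x, -, hx⟩ := Finset.mem_image.1 (Finset.mem_coe.1 ht)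
    have := pow_mul_pow_inj hp hq h hx
    omega
  · rw [Finset.sum_image hinj.injOn]
    have hterm : ∀ x ∈ latticeTriangle (Real.log p) (Real.log q) Z,
        (τ x : ℝ) ≤ (p ^ K * q ^ K : ℕ) * Real.exp Z := by
      intro x hx
      rw [mem_latticeTriangle ha hb hZ, ← log_pow_mul_pow hp hq] at hx
      have hpos : (0 : ℝ) < (p ^ x.2 * q ^ x.1 : ℕ) := by positivity
      have hle : ((p ^ x.2 * q ^ x.1 : ℕ) : ℝ) ≤ Real.exp Z := (Real.log_le_iff_le_exp hpos).1 hx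
      have heq : τ x = p ^ K * q ^ K * (p ^ x.2 * q ^ x.1) := by
        simp only [hτ, pow_add]
        ring
      rw [heq, Nat.cast_mul]
      exact mul_le_mul_of_nonneg_left hle (Nat.cast_nonneg _)
    have hsum := Finset.sum_le_card_nsmul _ _ _ hterm
    rw [nsmul_eq_mul] at hsum
    have hcard := mul_le_mul_of_nonneg_right (card_latticeTriangle_le ha hb hZ)
      (show 0 ≤ ((p ^ K * q ^ K : ℕ) : ℝ) * Real.exp Z by positivity)
    have hfin : (((∑ x ∈ latticeTriangle (Real.log p) (Real.log q) Z, τ x) + n₀ : ℕ) : ℝ) ≤ n := by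
      rw [Nat.cast_add, Nat.cast_sum]
      refine le_trans ?_ hn
      refine add_le_add_left (hsum.trans (hcard.trans (le_of_eq ?_))) _
      ring
    exact_mod_cast hfin

/-! ### Asymptotics -/

theorem tendsto_add_const_div_self (d : ℝ) :
    Tendsto (fun x : ℝ => (x + d) / x) atTop (𝓝 1) := by
  have h : Tendsto (fun x : ℝ => 1 + d / x) atTop (𝓝 (1 + 0)) :=
    tendsto_const_nhds.add (tendsto_const_nhds.div_atTop tendsto_id)
  rw [add_zero] at h
  refine h.congr' ?_
  filter_upwards [eventually_gt_atTop 0] with x hx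
  field_simp

theorem tendsto_sub_log_div_self :
    Tendsto (fun x : ℝ => (x - 3 * Real.log x) / x) atTop (𝓝 1) := by
  have h : Tendsto (fun x : ℝ => 1 - 3 * (Real.log x / x)) atTop (𝓝 (1 - 3 * 0)) :=
    tendsto_const_nhds.sub (Real.isLittleO_log_id_atTop.tendsto_div_nhds_zero.const_mul 3)
  rw [mul_zero, sub_zero] at h
  refine h.congr' ?_
  filter_upwards [eventually_gt_atTop 0] with x hx
  field_simp

/-- Subtracting 3 log x divides the exponential by x³, which beats the quadratic factor. The half
left over later accommodates n₀. -/
theorem eventually_const_mul_sq_mul_exp_le (c d : ℝ) :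
    ∀ᶠ x : ℝ in atTop, c * (x - 3 * Real.log x + d) ^ 2 * Real.exp (x - 3 * Real.log x) ≤
      Real.exp x / 2 := by
  have h1 : Tendsto (fun x : ℝ => (x - 3 * Real.log x) / x + d / x) atTop (𝓝 (1 + 0)) :=
    tendsto_sub_log_div_self.add (tendsto_const_nhds.div_atTop tendsto_id)
  have h2 := ((h1.pow 2).const_mul c).mul tendsto_inv_atTop_zero
  rw [mul_zero] at h2
  filter_upwards [h2.eventually_le_const (show (0 : ℝ) < 1 / 2 by norm_num),
    eventually_gt_atTop 0] with x hx hx0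
  have h3 : Real.exp (3 * Real.log x) = x ^ 3 := by
    rw [show 3 * Real.log x = Real.log (x ^ 3) by rw [Real.log_pow]; norm_num,
      Real.exp_log (by positivity)]
  calc _ = Real.exp x * (c * ((x - 3 * Real.log x) / x + d / x) ^ 2 * x⁻¹) := by
        rw [Real.exp_sub, h3]
        field_simp
    _ ≤ Real.exp x * (1 / 2) := mul_le_mul_of_nonneg_left hx (Real.exp_pos x).le
    _ = _ := by ring

theorem corollary1 (p q : ℕ) (hp : 1 < p) (hpq : p < q) (hcop : Nat.Coprime p q) :
    Asymptotics.IsEquivalent Filter.atTop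
      (fun n : ℕ => Real.log (numExpressions p q n : ℝ))
      (fun n : ℕ =>
        Real.log 2 * (Real.log (n : ℝ)) ^ 2 / (2 * Real.log (p : ℝ) * Real.log (q : ℝ))) := by
  have hq : 1 < q := hp.trans hpq
  obtain ⟨c, n₀, hlow⟩ := exists_le_numExpressions hp hq hcop
  have ha : 0 < Real.log p := Real.log_pos (by exact_mod_cast hp)
  have hb : 0 < Real.log q := Real.log_pos (by exact_mod_cast hq)
  have h2 : 0 < Real.log 2 := Real.log_pos one_lt_two
  set a := Real.log (p : ℝ)
  set b := Real.log (q : ℝ)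
  have hL : Tendsto (fun n : ℕ => Real.log (n : ℝ)) atTop atTop :=
    Real.tendsto_log_atTop.comp tendsto_natCast_atTop_atTop
  have hZ : ∀ᶠ x : ℝ in atTop, 0 ≤ x - 3 * Real.log x := by
    filter_upwards [tendsto_sub_log_div_self.eventually_const_le zero_lt_one,
      eventually_gt_atTop 0] with x hx hx0
    simpa using (le_div_iff₀ hx0).1 hx
  have hbounds : ∀ᶠ n : ℕ in atTop,
      (Real.log n - 3 * Real.log (Real.log n)) ^ 2 / (2 * a * b) * Real.log 2 ≤
        Real.log (numExpressions p q n) ∧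
      Real.log (numExpressions p q n) ≤
        (Real.log n + (a + b)) ^ 2 / (2 * a * b) * Real.log 2 := by
    filter_upwards [hL.eventually hZ,
      hL.eventually (eventually_const_mul_sq_mul_exp_le c (a + b)),
      eventually_ge_atTop (2 * n₀), eventually_gt_atTop 0] with n hZn hexp hn hn0
    have hn0' : (0 : ℝ) < n := by exact_mod_cast hn0
    rw [Real.exp_log hn0'] at hexp
    have hn' : 2 * (n₀ : ℝ) ≤ n := by exact_mod_cast hn
    have hlow' := hlow n _ hZn (by rw [add_assoc _ a b]; linarith)
    have hpos : 0 < numExpressions p q n := lt_of_lt_of_le (by positivity) hlow'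
    constructor
    · refine (mul_le_mul_of_nonneg_right (le_card_latticeTriangle ha hb hZn) h2.le).trans ?_
      rw [← Real.log_pow]
      exact Real.log_le_log (by positivity) (by exact_mod_cast hlow')
    · rw [← add_assoc]
      refine le_trans ?_ (mul_le_mul_of_nonneg_right
        (card_latticeTriangle_le ha hb (Real.log_natCast_nonneg n)) h2.le)
      rw [← Real.log_pow]
      exact Real.log_le_log (by exact_mod_cast hpos) (by exact_mod_cast numExpressions_le hp hq n)
  refine Asymptotics.isEquivalent_of_tendsto_one ?_
  -- Divided by the main term, both bounds become squares of ratios tending to 1.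
  have hlo := ((tendsto_sub_log_div_self.comp hL).pow 2)
  have hhi := (((tendsto_add_const_div_self (a + b)).comp hL).pow 2)
  rw [one_pow] at hlo hhi
  refine tendsto_of_tendsto_of_tendsto_of_le_of_le' hlo hhi ?_ ?_
  · filter_upwards [hbounds, hL.eventually (eventually_gt_atTop 0)] with n hn hpos
    simp only [Function.comp_apply, Pi.div_apply]
    rw [le_div_iff₀ (by positivity)]
    refine le_trans (le_of_eq ?_) hn.1
    field_simp
  · filter_upwards [hbounds, hL.eventually (eventually_gt_atTop 0)] with n hn hpos
    simp only [Function.comp_apply, Pi.div_apply]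
    rw [div_le_iff₀ (by positivity)]
    refine hn.2.trans (le_of_eq ?_)
    field_simp
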